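/- Let $\mathbb F_q$ be a finite field and let $\mathcal C\subseteq\mathbb F_q[x]^n$ be a convolutional code, i.e. an $\mathbb F_q[x]$-submodule, of rank $k\ge 1$. Let $G=\sum_i G_ix^i\in\mathbb F_q[x]^{k\times n}$ be any generator matrix of $\mathcal C$ (its rows form an $\mathbb F_q[x]$-basis of $\mathcal C$), and let $\delta$ be the internal degree of $\mathcal C$, i.e. the maximal degree of a $k\times k$ minor of $G$. The support of a set of vectors is the set of coordinates at which some vector of the set is nonzero, and the weight of a vector is the size of its support; a vector in $\mathbb F_q[x]^n$ is regarded here as the family of all coefficients of its entries. For $j\ge 0$ let $G_j^c\in\mathbb F_q^{k(j+1)\times n(j+1)}$ be the block upper triangular matrix whose $(s,t)$ block, $0\le s,t\le j$, is $G_{t-s}$ if $s\le t$ and $0$ otherwise, and write $v=(v^0,\dots,v^j)$ with $v^s\in\mathbb F_q^k$ for $v\in\mathbb F_q^{k(j+1)}$. Put $$\mathrm d_{\mathrm{free}}(\mathcal C)=\min\{\mathrm{wt}(c):0\ne c\in\mathcal C\},\qquad \mathrm d_j^c(\mathcal C)=\min\{\mathrm{wt}(vG_j^c): v\in\mathbb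 F_q^{k(j+1)},\ v^0\ne 0\},$$ and, for $1\le r\le k$, $$\mathrm d_r(\mathcal C)=\min\{|\mathrm{supp}\{d_1,\dots,d_r\}| : d_1,\dots,d_r\in\mathcal C,\ \mathrm{rk}\,\langle d_1,\dots,d_r\rangle_{\mathbb F_q[x]}\ge r\},$$ $$\mathrm d_j^r(\mathcal C)=\min\{|\mathrm{supp}\{v_1G_j^c,\dots,v_rG_j^c\}| : v_i\in\mathbb F_q^{k(j+1)},\ \dim\langle v_1^0,\dots,v_r^0\rangle_{\mathbb F_q}=r\},\qquad \mathrm d^r(\mathcal C)=\lim_{j\to\infty}\mathrm d_j^r(\mathcal C).$$ Assume that $\mathcal C$ is noncatastrophic ($G$ has a right inverse over $\mathbb F_q[x]$), MDS (maximum distance separable), i.e. $$\mathrm d_{\mathrm{free}}(\mathcal C)=(n-k)\left(\left\lfloor\tfrac{\delta}{k}\right\rfloor+1\right)+\delta+1,$$ and MDP (maximum distance profile), i.e. $\mathrm d_j^c(\mathcal C)=(n-k)(j+1)+1$ for all $0\le j\le\left\lfloor\frac{\delta}{k}\right\rfloor+\left\lfloor\frac{\delta}{n-k}\right\rfloor$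 (if $n=k$, the last summand is read as $0$). Then for every $1\le r\le k$ the limit defining $\mathrm d^r(\mathcal C)$ exists and $\mathrm d_r(\mathcal C)=\mathrm d^r(\mathcal C)$. -/

import Mathlib

open Polynomial Filter Topology

noncomputable section

namespace ConvCode

variable {F : Type*} [Field F] {k n : ℕ}

/-- `G` is a generator matrix of the convolutional code `C ⊆ F[x]^n`: its rows form a basis of the
`F[x]`-module `C`. In particular the number of rows `k` is the rank of `C`. -/
def IsGeneratorMatrix (C : Submodule F[X] (Fin n → F[X])) (G : Matrix (Fin k) (Fin n) F[X]) :
    Prop :=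
  LinearIndependent F[X] G.row ∧ Submodule.span F[X] (Set.range G.row) = C

/-- Every convolutional code has a generator matrix. -/
theorem exists_isGeneratorMatrix (C : Submodule F[X] (Fin n → F[X])) :
    ∃ G : Matrix (Fin (Module.finrank F[X] C)) (Fin n) F[X], IsGeneratorMatrix C G := by
  let b := Module.finBasis F[X] C
  refine ⟨fun i => (b i : Fin n → F[X]), ?_, ?_⟩
  · exact b.linearIndependent.map' C.subtype C.ker_subtype
  · have h : Set.range (fun i => (b i : Fin n → F[X])) = C.subtype '' Set.range b := by
      rw [← Set.range_comp]; rfl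
    change Submodule.span F[X] (Set.range (fun i => (b i : Fin n → F[X]))) = C
    rw [h, Submodule.span_image, b.span_eq, Submodule.map_top, Submodule.range_subtype]

/-- The internal degree `δ`: the largest degree of a full size (`k × k`) minor of `G`. -/
def internalDegree (G : Matrix (Fin k) (Fin n) F[X]) : ℕ :=
  Finset.univ.sup fun s : Fin k ↪o Fin n => (G.submatrix id s).det.natDegree

/-- The code generated by `G` is noncatastrophic: `G` is left prime, that is, it has a polynomial
right inverse. -/
def IsNoncatastrophic (G : Matrix (Fin k) (Fin n) F[X]) : Prop :=
  ∃ H : Matrix (Fin n) (Fin k) F[X], G * H = 1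

/-- The support of a set of vectors: the coordinates at which some vector of the set is nonzero. -/
def supp {ι : Type*} (S : Set (ι → F)) : Set ι :=
  {i | ∃ w ∈ S, w i ≠ 0}

/-- A polynomial vector `c = ∑ c[i] x^i` as the sequence of its coefficients, indexed by the
positions `(ℓ, i)` where `ℓ` is the component and `i` the exponent. -/
def coeffs (c : Fin n → F[X]) : Fin n × ℕ → F :=
  fun p => (c p.1).coeff p.2

/-- The free distance: the least weight of a nonzero codeword. -/
def freeDistance (C : Submodule F[X] (Fin n → F[X])) : ℕ :=
  sInf {m | ∃ c ∈ C, c ≠ 0 ∧ m = (supp {coeffs c}).ncard}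

/-- The `r`-th generalized weight `d_r(C)`. -/
def generalizedWeight (C : Submodule F[X] (Fin n → F[X])) (r : ℕ) : ℕ :=
  sInf {m | ∃ d : Fin r → Fin n → F[X], (∀ i, d i ∈ C) ∧
    r ≤ Module.finrank F[X] (Submodule.span F[X] (Set.range d)) ∧
    m = (supp (Set.range fun i => coeffs (d i))).ncard}

/-- The `j`-truncated sliding generator matrix `G_j^c`; its block in block row `s` and block
column `t` is the coefficient matrix `G_{t-s}` if `s ≤ t`, and `0` otherwise. -/
def slidingMatrix (G : Matrix (Fin k) (Fin n) F[X]) (j : ℕ) :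
    Matrix (Fin (j + 1) × Fin k) (Fin (j + 1) × Fin n) F :=
  fun p q => if p.1 ≤ q.1 then (G p.2 q.2).coeff ((q.1 : ℕ) - (p.1 : ℕ)) else 0

/-- The block `v^0` of a vector `v = (v^0, …, v^j)`. -/
def firstBlock {j : ℕ} (v : Fin (j + 1) × Fin k → F) : Fin k → F :=
  fun a => v (0, a)

/-- The `j`-th column distance `d_j^c`. -/
def columnDistance (G : Matrix (Fin k) (Fin n) F[X]) (j : ℕ) : ℕ :=
  sInf {m | ∃ v : Fin (j + 1) × Fin k → F, firstBlock v ≠ 0 ∧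
    m = (supp {Matrix.vecMul v (slidingMatrix G j)}).ncard}

/-- The `(r,j)`-generalized column distance `d_j^r`. -/
def truncGeneralizedColumnDistance (G : Matrix (Fin k) (Fin n) F[X]) (r j : ℕ) : ℕ :=
  sInf {m | ∃ v : Fin r → Fin (j + 1) × Fin k → F,
    Module.finrank F (Submodule.span F (Set.range fun i => firstBlock (v i))) = r ∧
    m = (supp (Set.range fun i => Matrix.vecMul (v i) (slidingMatrix G j))).ncard}

/-- The `r`-generalized column distance `d^r = lim_{j → ∞} d_j^r`. -/
def generalizedColumnDistance (G : Matrix (Fin k) (Fin n) F[X]) (r : ℕ) : ℕ :=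
  limUnder atTop fun j => truncGeneralizedColumnDistance G r j

/-- Maximum distance separable: the free distance of the `(n,k,δ)` code `C` with generator matrix
`G` attains the generalized Singleton bound. -/
def IsMDS (C : Submodule F[X] (Fin n → F[X])) (G : Matrix (Fin k) (Fin n) F[X]) : Prop :=
  freeDistance C = (n - k) * (internalDegree G / k + 1) + internalDegree G + 1

/-- Maximum distance profile: the column distances attain the bound `(n-k)(j+1)+1` for all
`j ≤ ⌊δ/k⌋ + ⌊δ/(n-k)⌋`. (If `n = k`, the second summand is read as `0`.) -/
def IsMDP (G : Matrix (Fin k) (Fin n) F[X]) : Prop :=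
  ∀ j ≤ internalDegree G / k + internalDegree G / (n - k),
    columnDistance G j = (n - k) * (j + 1) + 1

end ConvCode

end

open Polynomial Filter Topology

noncomputable section

namespace ConvCode

variable {F : Type*} [Field F] {k n : ℕ}

/-! Both weights are compared through supports of families of r polynomial messages.

For d_r ≤ d^r: the truncated distances increase with j and are bounded. Since F is finite, optimal
truncated families have a coordinatewise limit, a family of power series messages whose codewords
have finite joint support (`exists_seqSupp_ncard_le`). A polynomial right inverse of G turns these
messages into polynomials, and independent constant terms force F[X]-rank r.

For d^r ≤ d_r: take an optimal F[X]-independent family of messages. If the constant terms are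
independent over F, it is admissible for d^r; if they all vanish, divide by X and repeat. Otherwise
its F-span has a nonzero image in degree 0, where MDP at j = 0 gives distance at least n-k+1, and a
nonzero subspace without constant term, whose words have weight at least w = d_free. A Singleton
bound on each piece makes the support at least (n-k)+w+r-1 (`add_le_ncard_messageSupp`). The MDS
value of w is exactly what lets a dimension count produce a family with independent constant terms
and support at most this number (`exists_linearIndependent_firstMessage_of_boundedMessages`). -/

/-! ### Dimension of the space of codewords of bounded degree -/

open Module in
/-- Over `F[X]`, the cokernel of an endomorphism with nonzero determinant has `F`-dimension equal to
the degree of the determinant. -/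
theorem finrank_quotient_range_eq_natDegree_det {ι : Type*} [Fintype ι] [DecidableEq ι]
    (f : (ι → F[X]) →ₗ[F[X]] (ι → F[X])) (hf : LinearMap.det f ≠ 0) :
    Module.Finite F ((ι → F[X]) ⧸ LinearMap.range f) ∧
      finrank F ((ι → F[X]) ⧸ LinearMap.range f) = (LinearMap.det f).natDegree := by
  have hinj : Function.Injective f := by
    rw [← LinearMap.ker_eq_bot]
    by_contra h
    exact hf (LinearMap.det_eq_zero_iff_ker_ne_bot.2 h)
  let N := LinearMap.range f
  let e : (ι → F[X]) ≃ₗ[F[X]] N := LinearEquiv.ofInjective f hinj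
  have h : finrank F[X] N = finrank F[X] (ι → F[X]) := e.symm.finrank_eq
  let b : Basis ι F[X] (ι → F[X]) := Pi.basisFun _ _
  let a := Submodule.smithNormalFormCoeffs b h
  let b' := Submodule.smithNormalFormTopBasis b h
  let ab := Submodule.smithNormalFormBotBasis b h
  have ab_eq := Submodule.smithNormalFormBotBasis_def b h
  have a_ne : ∀ i, a i ≠ 0 := Submodule.smithNormalFormCoeffs_ne_zero b h
  let e' : (ι → F[X]) ≃ₗ[F[X]] N := b'.equiv ab (Equiv.refl _)
  let g : (ι → F[X]) →ₗ[F[X]] (ι → F[X]) := N.subtype ∘ₗ (e' : (ι → F[X]) →ₗ[F[X]] N)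
  have hg : ∀ i, g (b' i) = a i • b' i := by
    intro i
    change ((b'.equiv ab (Equiv.refl _) (b' i) : N) : ι → F[X]) = _
    rw [b'.equiv_apply, Equiv.refl_apply]
    exact ab_eq i
  have hdet : LinearMap.det g = ∏ i, a i := by
    rw [← LinearMap.det_toMatrix b', ← Matrix.det_diagonal]
    congr 1
    ext i j
    rw [LinearMap.toMatrix_apply, hg, map_smul, Basis.repr_self, Finsupp.smul_single,
      smul_eq_mul, mul_one]
    by_cases h : i = j
    · rw [h, Matrix.diagonal_apply_eq, Finsupp.single_eq_same]
    · rw [Matrix.diagonal_apply_ne _ h, Finsupp.single_eq_of_ne h]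
  -- Both `f` and `g` are isomorphisms onto N followed by the inclusion, so their determinants
  -- differ by a unit.
  have hassoc : Associated (LinearMap.det f) (∏ i, a i) := by
    rw [← hdet]
    exact LinearMap.associated_det_comp_equiv N.subtype e e'
  have hfin : ∀ i, FiniteDimensional F (F[X] ⧸ Ideal.span ({a i} : Set F[X])) := fun i =>
    PowerBasis.finite <| AdjoinRoot.powerBasis <| a_ne i
  refine ⟨Module.Finite.equiv (Submodule.quotientEquivDirectSum F b h).symm, ?_⟩
  rw [natDegree_eq_of_degree_eq (degree_eq_degree_of_associated hassoc),
    natDegree_prod _ _ fun i _ => a_ne i]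
  refine (Submodule.finrank_quotient_eq_sum F b h).trans ?_
  congr with i
  exact (AdjoinRoot.powerBasis <| a_ne i).finrank

/-- Encoding `u ↦ u G` as an `F`-linear map. -/
def encode (G : Matrix (Fin k) (Fin n) F[X]) : (Fin k → F[X]) →ₗ[F] (Fin n → F[X]) :=
  G.vecMulLinear.restrictScalars F

@[simp]
theorem encode_apply (G : Matrix (Fin k) (Fin n) F[X]) (u : Fin k → F[X]) :
    encode G u = Matrix.vecMul u G := rfl

/-- Vectors of polynomials of degree less than `D`. -/
def degreeLTPi (F : Type*) [Field F] (n D : ℕ) : Submodule F (Fin n → F[X]) :=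
  Submodule.pi Set.univ fun _ => degreeLT F D

theorem mem_degreeLTPi {D : ℕ} {c : Fin n → F[X]} :
    c ∈ degreeLTPi F n D ↔ ∀ i, (c i).degree < D := by
  simp [degreeLTPi, Submodule.mem_pi, mem_degreeLT]

theorem degreeLTPi_eq_range (D : ℕ) :
    degreeLTPi F n D = LinearMap.range
      (LinearMap.pi fun i => (degreeLT F D).subtype ∘ₗ LinearMap.proj i :
        (Fin n → degreeLT F D) →ₗ[F] (Fin n → F[X])) := by
  ext c
  simp only [degreeLTPi, Submodule.mem_pi, Set.mem_univ, true_implies, LinearMap.mem_range]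
  constructor
  · intro h
    exact ⟨fun i => ⟨c i, h i⟩, by ext1 i; rfl⟩
  · rintro ⟨y, rfl⟩ i
    exact (y i).2

instance finite_degreeLT (D : ℕ) : Module.Finite F (degreeLT F D) :=
  Module.Finite.equiv (degreeLTEquiv F D).symm

instance finite_degreeLTPi (D : ℕ) : Module.Finite F (degreeLTPi F n D) := by
  rw [degreeLTPi_eq_range]
  infer_instance

theorem finrank_degreeLTPi (D : ℕ) : Module.finrank F (degreeLTPi F n D) = n * D := by
  rw [degreeLTPi_eq_range, LinearMap.finrank_range_of_inj, Module.finrank_pi_fintype]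
  · simp [(degreeLTEquiv F D).finrank_eq]
  · intro x y h
    ext i : 2
    exact congrFun h i

/-- The messages whose codeword has all entries of degree less than `D`. -/
def boundedMessages (G : Matrix (Fin k) (Fin n) F[X]) (D : ℕ) : Submodule F (Fin k → F[X]) :=
  (degreeLTPi F n D).comap (encode G)

theorem mem_boundedMessages {G : Matrix (Fin k) (Fin n) F[X]} {D : ℕ} {u : Fin k → F[X]} :
    u ∈ boundedMessages G D ↔ ∀ i, (Matrix.vecMul u G i).degree < D := by
  simp [boundedMessages, mem_degreeLTPi]

theorem encode_injective {G : Matrix (Fin k) (Fin n) F[X]} (hnc : IsNoncatastrophic G) :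
    Function.Injective (encode G) := by
  obtain ⟨H, hH⟩ := hnc
  intro u v h
  have := congrArg (fun c => Matrix.vecMul c H) h
  simpa [Matrix.vecMul_vecMul, hH] using this

theorem finite_boundedMessages {G : Matrix (Fin k) (Fin n) F[X]} (hnc : IsNoncatastrophic G)
    (D : ℕ) : Module.Finite F (boundedMessages G D) := by
  let f : boundedMessages G D →ₗ[F] degreeLTPi F n D :=
    (encode G).restrict fun u hu => hu
  refine Module.Finite.of_injective f fun u v h => Subtype.ext (encode_injective hnc ?_)
  exact congrArg Subtype.val h

/-- The internal degree only sees increasing column selections. A repeated column kills the minor,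
and reordering columns changes only its sign. -/
theorem natDegree_det_submatrix_le (G : Matrix (Fin k) (Fin n) F[X]) (f : Fin k → Fin n) :
    (G.submatrix id f).det.natDegree ≤ internalDegree G := by
  by_cases hf : Function.Injective f
  · have hcard : (Finset.univ.image f).card = k := by
      simp [Finset.card_image_of_injective _ hf]
    let s : Fin k ↪o Fin n := (Finset.univ.image f).orderEmbOfFin hcard
    have hs : ∀ i, ∃ j, s j = f i := fun i => by
      have : f i ∈ Set.range s := by simp [s]
      exact this
    choose σ hσ using hs
    have hσi : Function.Injective σ := fun a b h => hf (by rw [← hσ a, ← hσ b, h])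
    let τ : Equiv.Perm (Fin k) := Equiv.ofBijective σ (Finite.injective_iff_bijective.1 hσi)
    have : G.submatrix id f = (G.submatrix id s).submatrix id τ := by
      ext i j
      simp [τ, hσ]
    rw [this, Matrix.det_permute']
    have hle : (G.submatrix id s).det.natDegree ≤ internalDegree G :=
      Finset.le_sup (f := fun s : Fin k ↪o Fin n => (G.submatrix id s).det.natDegree)
        (Finset.mem_univ s)
    rcases Int.units_eq_one_or (Equiv.Perm.sign τ) with h | h <;> simpa [h] using hle
  · simp only [Function.Injective, not_forall] at hf
    obtain ⟨a, b, hab, hne⟩ := hf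
    rw [Matrix.det_zero_of_column_eq hne (fun i => by simp [hab])]
    simp

/-- A right inverse makes the columns of A span, so some of them form a basis. -/
theorem exists_det_submatrix_ne_zero {R : Type*} [Field R] {A : Matrix (Fin k) (Fin n) R}
    {B : Matrix (Fin n) (Fin k) R} (h : A * B = 1) :
    ∃ f : Fin k → Fin n, (A.submatrix id f).det ≠ 0 := by
  have hspan : Submodule.span R (Set.range A.col) = ⊤ := by
    rw [← Matrix.range_mulVecLin, LinearMap.range_eq_top]
    intro y
    exact ⟨Matrix.mulVec B y, by simp [h]⟩
  obtain ⟨κ, a, ha, hsp, hli⟩ := exists_linearIndependent' R A.col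
  rw [hspan] at hsp
  let b : Module.Basis κ R (Fin k → R) := Module.Basis.mk hli hsp.ge
  let e : κ ≃ Fin k := b.indexEquiv (Pi.basisFun R (Fin k))
  refine ⟨a ∘ e.symm, ?_⟩
  have h2 : LinearIndependent R (A.submatrix id (a ∘ e.symm)).col :=
    hli.comp e.symm e.symm.injective
  rw [Matrix.linearIndependent_cols_iff_isUnit, Matrix.isUnit_iff_isUnit_det] at h2
  exact h2.ne_zero

theorem exists_det_submatrix_ne_zero_of_isNoncatastrophic {G : Matrix (Fin k) (Fin n) F[X]}
    (hnc : IsNoncatastrophic G) : ∃ f : Fin k → Fin n, (G.submatrix id f).det ≠ 0 := by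
  obtain ⟨H, hH⟩ := hnc
  obtain ⟨f, hf⟩ := exists_det_submatrix_ne_zero (A := G.map (constantCoeff (R := F)))
    (B := H.map (constantCoeff (R := F))) (by rw [← Matrix.map_mul, hH]; simp)
  refine ⟨f, fun h => hf ?_⟩
  have := RingHom.map_det (constantCoeff (R := F)) (G.submatrix id f)
  rw [h, map_zero] at this
  rw [this]
  rfl

/-- If the columns `f` carry a minor of maximal degree then the degree of a codeword is controlled by
its entries at `f`. -/
theorem degree_lt_of_degree_submatrix_lt {G : Matrix (Fin k) (Fin n) F[X]} {f : Fin k → Fin n}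
    (hf : (G.submatrix id f).det ≠ 0)
    (hmax : ∀ g : Fin k → Fin n,
      (G.submatrix id g).det.natDegree ≤ (G.submatrix id f).det.natDegree)
    {u : Fin k → F[X]} {D : ℕ} (hu : ∀ i, (Matrix.vecMul u (G.submatrix id f) i).degree < D)
    (j : Fin n) : (Matrix.vecMul u G j).degree < D := by
  set A := G.submatrix id f with hA
  -- Cramer's rule for column j of G, paired with u.
  have key : A.det * Matrix.vecMul u G j =
      ∑ i, Matrix.vecMul u A i * A.cramer (fun a => G a j) i := by
    have h1 : dotProduct u (Matrix.mulVec A (A.cramer fun a => G a j)) =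
        dotProduct u (A.det • fun a => G a j) := by rw [Matrix.mulVec_cramer]
    rw [Matrix.dotProduct_mulVec, dotProduct_smul] at h1
    exact h1.symm
  have hcr : ∀ i, (A.cramer (fun a => G a j) i).degree ≤ A.det.degree := by
    intro i
    rw [Matrix.cramer_apply]
    -- The Cramer numerators are again full size minors of G, so maximality of det A bounds their
    -- degrees.
    have : A.updateCol i (fun a => G a j) = G.submatrix id (Function.update f i j) := by
      ext a b
      by_cases hb : b = i
      · subst hb; simp
      · simp [hb, hA]
    rw [this, degree_eq_natDegree hf]
    exact natDegree_le_iff_degree_le.1 (hmax _)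
  by_contra hcon
  push Not at hcon
  have hne : Matrix.vecMul u G j ≠ 0 := by
    intro h
    rw [h, degree_zero] at hcon
    simp at hcon
  have hlt : (A.det * Matrix.vecMul u G j).degree < A.det.degree + D := by
    rw [key]
    refine (degree_sum_le _ _).trans_lt ((Finset.sup_lt_iff ?_).2 fun i _ => ?_)
    · rw [bot_lt_iff_ne_bot, degree_eq_natDegree hf]
      exact WithBot.coe_ne_bot
    · by_cases h0 : Matrix.vecMul u A i = 0
      · rw [h0, zero_mul, degree_zero, bot_lt_iff_ne_bot, degree_eq_natDegree hf]
        exact WithBot.coe_ne_bot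
      by_cases h1 : A.cramer (fun a => G a j) i = 0
      · rw [h1, mul_zero, degree_zero, bot_lt_iff_ne_bot, degree_eq_natDegree hf]
        exact WithBot.coe_ne_bot
      have h2 := hu i
      have h3 := hcr i
      rw [degree_mul, degree_eq_natDegree hf, degree_eq_natDegree h0, degree_eq_natDegree h1]
      rw [degree_eq_natDegree h0] at h2
      rw [degree_eq_natDegree hf, degree_eq_natDegree h1] at h3
      norm_cast at *
      omega
  rw [degree_mul, degree_eq_natDegree hf, degree_eq_natDegree hne] at hlt
  rw [degree_eq_natDegree hne] at hcon
  norm_cast at *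
  omega

/-- Let A consist of the columns of a minor of maximal degree. Vectors of degree less than D in the
row module of A have codimension at most deg det A, and each is uA for some u whose whole codeword
uG has degree less than D. -/
theorem le_finrank_boundedMessages {G : Matrix (Fin k) (Fin n) F[X]} (hnc : IsNoncatastrophic G)
    (D : ℕ) : k * D ≤ Module.finrank F (boundedMessages G D) + internalDegree G := by
  classical
  obtain ⟨f₀, hf₀⟩ := exists_det_submatrix_ne_zero_of_isNoncatastrophic hnc
  obtain ⟨f, hf, hmax⟩ := Finset.exists_max_image
    (Finset.univ.filter fun f : Fin k → Fin n => (G.submatrix id f).det ≠ 0)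
    (fun f => (G.submatrix id f).det.natDegree) ⟨f₀, by simpa using hf₀⟩
  simp only [Finset.mem_filter, Finset.mem_univ, true_and] at hf hmax
  replace hmax : ∀ g : Fin k → Fin n,
      (G.submatrix id g).det.natDegree ≤ (G.submatrix id f).det.natDegree := fun g => by
    by_cases hg : (G.submatrix id g).det = 0
    · simp [hg]
    · exact hmax g hg
  set A := G.submatrix id f with hA
  let φ := A.vecMulLinear
  have hdet : LinearMap.det φ = A.det := by
    have : φ = Matrix.toLin' A.transpose := by
      ext1 i
      ext1
      simp [φ]
    rw [this, LinearMap.det_toLin', Matrix.det_transpose]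
  obtain ⟨hfin, hrank⟩ := finrank_quotient_range_eq_natDegree_det φ (by rw [hdet]; exact hf)
  let q : degreeLTPi F k D →ₗ[F] ((Fin k → F[X]) ⧸ LinearMap.range φ) :=
    ((LinearMap.range φ).mkQ.restrictScalars F) ∘ₗ (degreeLTPi F k D).subtype
  have h1 := LinearMap.finrank_range_add_finrank_ker q
  rw [finrank_degreeLTPi] at h1
  have h2 : Module.finrank F (LinearMap.range q) ≤ internalDegree G := by
    refine (Submodule.finrank_le _).trans ?_
    rw [hrank, hdet]
    exact natDegree_det_submatrix_le G f
  have h3 : Module.finrank F (LinearMap.ker q) ≤ Module.finrank F (boundedMessages G D) := by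
    have := finite_boundedMessages hnc D
    rw [← Submodule.finrank_map_subtype_eq]
    refine le_trans (Submodule.finrank_mono (?_ : _ ≤ (boundedMessages G D).map
      (φ.restrictScalars F))) (Submodule.finrank_map_le _ _)
    rintro _ ⟨⟨c, hc⟩, hcq, rfl⟩
    have hcr : c ∈ LinearMap.range φ := by
      have : (LinearMap.range φ).mkQ c = 0 := hcq
      simpa using this
    obtain ⟨u, rfl⟩ := hcr
    refine ⟨u, ?_, rfl⟩
    rw [mem_degreeLTPi] at hc
    exact mem_boundedMessages.2 fun j => degree_lt_of_degree_submatrix_lt hf hmax hc j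
  omega

/-! ### Supports, puncturing and the Singleton bound -/

theorem mem_supp {ι : Type*} {S : Set (ι → F)} {i : ι} : i ∈ supp S ↔ ∃ w ∈ S, w i ≠ 0 := Iff.rfl

theorem apply_eq_zero_of_mem_span {ι : Type*} {S : Set (ι → F)} {i : ι} (hi : i ∉ supp S)
    {v : ι → F} (hv : v ∈ Submodule.span F S) : v i = 0 := by
  have : Submodule.span F S ≤ LinearMap.ker (LinearMap.proj i : (ι → F) →ₗ[F] F) := by
    rw [Submodule.span_le]
    intro w hw
    by_contra h
    exact hi ⟨w, hw, h⟩
  exact this hv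

section Puncturing

variable {ι M : Type*} [AddCommGroup M] [Module F M]

/-- The vectors whose image under `g` vanishes at the positions of `T`. -/
def vanishOn (g : M →ₗ[F] (ι → F)) (T : Finset ι) : Submodule F M :=
  LinearMap.ker (LinearMap.funLeft F F (Subtype.val : T → ι) ∘ₗ g)

theorem mem_vanishOn {g : M →ₗ[F] (ι → F)} {T : Finset ι} {u : M} :
    u ∈ vanishOn g T ↔ ∀ i ∈ T, g u i = 0 := by
  simp [vanishOn, funext_iff, LinearMap.funLeft]

/-- Each position of T imposes one linear condition. -/
theorem finrank_le_finrank_inf_vanishOn (g : M →ₗ[F] (ι → F)) (T : Finset ι) (Y : Submodule F M)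
    [Module.Finite F Y] :
    Module.finrank F Y ≤ Module.finrank F (Y ⊓ vanishOn g T : Submodule F M) + T.card := by
  let q : Y →ₗ[F] (T → F) := (LinearMap.funLeft F F (Subtype.val : T → ι) ∘ₗ g) ∘ₗ Y.subtype
  have h1 := LinearMap.finrank_range_add_finrank_ker q
  have h2 : Module.finrank F (LinearMap.range q) ≤ T.card := by
    refine (Submodule.finrank_le _).trans ?_
    simp
  have h3 : Module.finrank F (LinearMap.ker q) ≤
      Module.finrank F (Y ⊓ vanishOn g T : Submodule F M) := by
    have : Module.Finite F (Y ⊓ vanishOn g T : Submodule F M) :=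
      Submodule.finiteDimensional_of_le inf_le_left
    rw [← Submodule.finrank_map_subtype_eq]
    refine Submodule.finrank_mono ?_
    rintro _ ⟨⟨u, hu⟩, huq, rfl⟩
    exact ⟨hu, huq⟩
  omega

/-- A linear code of minimum distance at least `w` and dimension `K ≥ 1` has support of size at least
`w + K - 1`. -/
theorem add_finrank_le_card_add_one (V : Submodule F (ι → F)) [Module.Finite F V] (S : Finset ι)
    (hS : ∀ v ∈ V, ∀ i ∉ S, v i = 0) (w : ℕ) (hw : ∀ v ∈ V, v ≠ 0 → w ≤ (supp {v}).ncard)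
    (hV : 1 ≤ Module.finrank F V) : w + Module.finrank F V ≤ S.card + 1 := by
  classical
  have hB := fun T : Finset ι => finrank_le_finrank_inf_vanishOn LinearMap.id T V
  have hle : Module.finrank F V ≤ S.card := by
    have h := hB S
    have h0 : (V ⊓ vanishOn LinearMap.id S : Submodule F (ι → F)) = ⊥ := by
      rw [eq_bot_iff]
      rintro v ⟨hv, hv'⟩
      rw [SetLike.mem_coe, mem_vanishOn] at hv'
      rw [Submodule.mem_bot]
      ext i
      by_cases hi : i ∈ S
      · exact hv' i hi
      · exact hS v hv i hi
    rw [h0, finrank_bot] at h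
    omega
  -- Vanishing at dim V - 1 positions of S still leaves a nonzero word, whose weight is at most |S|
  -- - dim V + 1.
  obtain ⟨T, hTS, hT⟩ := Finset.exists_subset_card_eq
    (show Module.finrank F V - 1 ≤ S.card by omega)
  have h := hB T
  have hne : (V ⊓ vanishOn LinearMap.id T : Submodule F (ι → F)) ≠ ⊥ := by
    intro h0
    rw [h0, finrank_bot] at h
    omega
  obtain ⟨v, ⟨hv, hvT⟩, hv0⟩ := Submodule.exists_mem_ne_zero_of_ne_bot hne
  rw [SetLike.mem_coe, mem_vanishOn] at hvT
  have h1 := hw v hv hv0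
  have h2 : (supp {v}).ncard ≤ (S \ T).card := by
    rw [← Set.ncard_coe_finset]
    refine Set.ncard_le_ncard ?_ (Finset.finite_toSet _)
    rintro i ⟨_, rfl, hi⟩
    simp only [Finset.coe_sdiff, Set.mem_sdiff, Finset.mem_coe]
    exact ⟨by_contra fun h => hi (hS _ hv i h), fun h => hi (hvT i h)⟩
  rw [Finset.card_sdiff_of_subset hTS] at h2
  omega

end Puncturing

/-! ### A family of small support with independent constant terms -/

/-- The coefficients of the codeword `u G`, as an `F`-linear map in the message `u`. -/
def encodeCoeffs (G : Matrix (Fin k) (Fin n) F[X]) : (Fin k → F[X]) →ₗ[F] (Fin n × ℕ → F) :=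
  LinearMap.pi fun p => Polynomial.lcoeff F p.2 ∘ₗ LinearMap.proj p.1 ∘ₗ encode G

theorem encodeCoeffs_apply_apply (G : Matrix (Fin k) (Fin n) F[X]) (u : Fin k → F[X])
    (p : Fin n × ℕ) : encodeCoeffs G u p = (Matrix.vecMul u G p.1).coeff p.2 := rfl

theorem encodeCoeffs_injective {G : Matrix (Fin k) (Fin n) F[X]} (hnc : IsNoncatastrophic G) :
    Function.Injective (encodeCoeffs G) := by
  intro u v h
  refine encode_injective hnc ?_
  ext l i
  exact congrFun h (l, i)

/-- The support of the code spanned by the codewords of a family of messages. -/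
def messageSupp {ι : Type*} (G : Matrix (Fin k) (Fin n) F[X]) (u : ι → Fin k → F[X]) :
    Set (Fin n × ℕ) :=
  supp (Set.range fun i => coeffs (Matrix.vecMul (u i) G))

theorem mem_messageSupp {ι : Type*} {G : Matrix (Fin k) (Fin n) F[X]} {u : ι → Fin k → F[X]}
    {p : Fin n × ℕ} : p ∈ messageSupp G u ↔ ∃ i, (Matrix.vecMul (u i) G p.1).coeff p.2 ≠ 0 := by
  simp [messageSupp, mem_supp, coeffs]

theorem finite_messageSupp {ι : Type*} [Finite ι] (G : Matrix (Fin k) (Fin n) F[X])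
    (u : ι → Fin k → F[X]) : (messageSupp G u).Finite := by
  have : messageSupp G u ⊆ ⋃ i, ⋃ l, (fun t => (l, t)) '' ((Matrix.vecMul (u i) G l).support) := by
    rintro ⟨l, t⟩ hp
    obtain ⟨i, hi⟩ := mem_messageSupp.1 hp
    simp only [Set.mem_iUnion]
    exact ⟨i, l, t, by simpa using hi, rfl⟩
  refine Set.Finite.subset ?_ this
  exact Set.finite_iUnion fun i => Set.finite_iUnion fun l => (Finset.finite_toSet _).image _

/-- The constant coefficients of a message. -/
def firstMessage : (Fin k → F[X]) →ₗ[F] (Fin k → F) :=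
  LinearMap.pi fun a => Polynomial.lcoeff F 0 ∘ₗ LinearMap.proj a

@[simp]
theorem firstMessage_apply (u : Fin k → F[X]) (a : Fin k) :
    firstMessage u a = (u a).coeff 0 := rfl

theorem coeff_zero_vecMul (G : Matrix (Fin k) (Fin n) F[X]) (u : Fin k → F[X]) (l : Fin n) :
    (Matrix.vecMul u G l).coeff 0 =
      Matrix.vecMul (firstMessage u) (G.map (constantCoeff (R := F))) l := by
  simp [Matrix.vecMul, dotProduct, finsetSum_coeff, mul_coeff_zero]

/-- Among words of degree at most m+1, where m = ⌊δ/k⌋, enough zeros are prescribed in positive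
degrees that a word without constant term would have weight less than w. The remaining freedom is
spent on further zeros until only dimension r is guaranteed. -/
theorem exists_linearIndependent_firstMessage_of_boundedMessages
    {G : Matrix (Fin k) (Fin n) F[X]} (hnc : IsNoncatastrophic G) (hk : 1 ≤ k) (hkn : k ≤ n)
    {w : ℕ} (hw : ∀ u : Fin k → F[X], u ≠ 0 → w ≤ (supp {coeffs (Matrix.vecMul u G)}).ncard)
    (hwδ : w = (n - k) * (internalDegree G / k + 1) + internalDegree G + 1)
    {r : ℕ} (hrk : r ≤ k) :
    ∃ u : Fin r → Fin k → F[X], LinearIndependent F (fun i => firstMessage (u i)) ∧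
      (messageSupp G u).ncard + 1 ≤ (n - k) + w + r := by
  classical
  obtain ⟨e, rfl⟩ := Nat.exists_eq_add_of_le hkn
  set δ := internalDegree G with hδ
  set m := δ / k with hm
  have h1 : k * m ≤ δ := Nat.mul_div_le _ _
  have h2 : δ < k * m + k := by
    have := Nat.lt_mul_div_succ δ (show 0 < k by omega)
    rw [mul_add, mul_one] at this
    exact this
  rw [Nat.add_sub_cancel_left] at hwδ ⊢
  -- With t = k(m+1) - δ, the n(m+1) positions of degree 1 to m+1 exceed t by exactly w - 1.
  obtain ⟨t, ht⟩ : ∃ t, t + δ = k * m + k := ⟨k * m + k - δ, by omega⟩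
  have hw' : w = e * m + e + δ + 1 := by rw [hwδ]; ring
  let W := boundedMessages G (m + 2)
  have hWfin : Module.Finite F W := finite_boundedMessages hnc _
  have hWrank : k * m + k + k ≤ Module.finrank F W + δ := by
    have := le_finrank_boundedMessages hnc (m + 2)
    rw [mul_add] at this
    change _ ≤ Module.finrank F W + δ at this
    omega
  let S : Finset (Fin (k + e) × ℕ) := Finset.univ ×ˢ Finset.range (m + 2)
  have hScard : S.card = k * m + k + k + e * m + e + e := by
    simp [S, Finset.card_product]; ring
  let S₁ : Finset (Fin (k + e) × ℕ) := Finset.univ ×ˢ Finset.Icc 1 (m + 1)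
  have hS₁card : S₁.card = k * m + k + e * m + e := by
    simp [S₁, Finset.card_product]; ring
  have hS₁S : S₁ ⊆ S := by
    intro p
    simp only [S₁, S, Finset.mem_product, Finset.mem_univ, true_and, Finset.mem_Icc,
      Finset.mem_range]
    omega
  obtain ⟨T, hTS, hT⟩ := Finset.exists_subset_card_eq (show t ≤ S₁.card by omega)
  -- The space W has dimension at least t + k, so t + (k - r) zeros leave dimension at least r.
  obtain ⟨T', hTT', hT'S, hT'⟩ := Finset.exists_subsuperset_card_eq (hTS.trans hS₁S)
    (n := t + (k - r)) (by omega) (by omega)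
  let Y : Submodule F (Fin k → F[X]) := W ⊓ vanishOn (encodeCoeffs G) T'
  have hYrank : r ≤ Module.finrank F Y := by
    have := finrank_le_finrank_inf_vanishOn (encodeCoeffs G) T' W
    change _ ≤ Module.finrank F Y + _ at this
    omega
  have hYS : ∀ u ∈ Y, ∀ p, encodeCoeffs G u p ≠ 0 → p ∈ S \ T' := by
    rintro u ⟨hu, hu'⟩ p hp
    rw [SetLike.mem_coe, mem_vanishOn] at hu'
    rw [Finset.mem_sdiff]
    refine ⟨?_, fun h => hp (hu' p h)⟩
    have := mem_boundedMessages.1 hu p.1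
    simp only [S, Finset.mem_product, Finset.mem_univ, true_and, Finset.mem_range]
    by_contra hcon
    exact hp (coeff_eq_zero_of_degree_lt (this.trans_le (by exact_mod_cast not_lt.1 hcon)))
  -- A zero constant message confines the codeword to S₁ \ T, which has only w - 1 elements.
  have hYinj : ∀ u ∈ Y, firstMessage u = 0 → u = 0 := by
    intro u hu hu0
    by_contra hne
    have hsub : supp {coeffs (Matrix.vecMul u G)} ⊆ (S₁ \ T : Finset _) := by
      rintro p ⟨_, rfl, hp⟩
      obtain ⟨hpS, hpT'⟩ := Finset.mem_sdiff.1 (hYS u hu p hp)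
      rw [Finset.mem_coe, Finset.mem_sdiff]
      refine ⟨?_, fun h => hpT' (hTT' h)⟩
      have : p.2 ≠ 0 := by
        intro h0
        apply hp
        change (Matrix.vecMul u G p.1).coeff p.2 = 0
        rw [h0, coeff_zero_vecMul, hu0, Matrix.zero_vecMul]
        rfl
      simp only [S₁, S, Finset.mem_product, Finset.mem_univ, true_and, Finset.mem_Icc,
        Finset.mem_range] at hpS ⊢
      omega
    have hle := Set.ncard_le_ncard hsub (Finset.finite_toSet _)
    rw [Set.ncard_coe_finset, Finset.card_sdiff_of_subset hTS] at hle
    have := hw u hne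
    omega
  obtain ⟨f, hf⟩ := exists_linearIndependent_of_le_finrank hYrank
  refine ⟨fun i => f i, ?_, ?_⟩
  · refine hf.map' (firstMessage ∘ₗ Y.subtype) ?_
    rw [LinearMap.ker_eq_bot']
    intro u hu
    exact Subtype.ext (hYinj u u.2 hu)
  · have hsub : messageSupp G (fun i => (f i : Fin k → F[X])) ⊆ (S \ T' : Finset _) := by
      intro p hp
      obtain ⟨i, hi⟩ := mem_messageSupp.1 hp
      exact hYS _ (f i).2 p hi
    have hle := Set.ncard_le_ncard hsub (Finset.finite_toSet _)
    rw [Set.ncard_coe_finset, Finset.card_sdiff_of_subset hT'S] at hle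
    omega

/-! ### Lower bound for mixed families, and reduction to independent constant terms -/

/-- The degree 0 part of the support carries the image of the span under `τ`; the positive degree
part carries the kernel. Both spaces are nonzero with dimensions adding to r, so the two Singleton
bounds add up. -/
theorem add_le_ncard_messageSupp {G : Matrix (Fin k) (Fin n) F[X]} (hnc : IsNoncatastrophic G)
    {w : ℕ} (hw : ∀ u : Fin k → F[X], u ≠ 0 → w ≤ (supp {coeffs (Matrix.vecMul u G)}).ncard)
    {w₀ : ℕ} (hw₀ : ∀ v : Fin k → F, v ≠ 0 →
      w₀ + 1 ≤ (supp {Matrix.vecMul v (G.map (constantCoeff (R := F)))}).ncard)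
    {r : ℕ} {d : Fin r → Fin k → F[X]} (hd : LinearIndependent F d)
    (hdep : ¬ LinearIndependent F fun i => firstMessage (d i))
    (hne : ∃ i, firstMessage (d i) ≠ 0) :
    w₀ + w + r ≤ (messageSupp G d).ncard + 1 := by
  classical
  let τ : (Fin k → F[X]) →ₗ[F] (Fin n → F) :=
    (G.map (constantCoeff (R := F))).vecMulLinear ∘ₗ firstMessage
  have hτ : ∀ u l, τ u l = (Matrix.vecMul u G l).coeff 0 := fun u l =>
    (coeff_zero_vecMul G u l).symm
  have hτ0 : ∀ u, τ u = 0 → firstMessage u = 0 := by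
    obtain ⟨H, hH⟩ := hnc
    intro u hu
    have h1 : G.map (constantCoeff (R := F)) * H.map (constantCoeff (R := F)) = 1 := by
      rw [← Matrix.map_mul, hH]; simp
    have h2 : Matrix.vecMul (firstMessage u) (G.map (constantCoeff (R := F))) = 0 := hu
    have := congrArg (fun c => Matrix.vecMul c (H.map (constantCoeff (R := F)))) h2
    simpa [Matrix.vecMul_vecMul, h1] using this
  let V := Submodule.span F (Set.range d)
  have hVfin : Module.Finite F V := Module.Finite.span_of_finite F (Set.finite_range d)
  have hV : Module.finrank F V = r := by
    simpa using finrank_span_eq_card hd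
  let V₁ : Submodule F (Fin k → F[X]) := V ⊓ LinearMap.ker τ
  have hV₁fin : Module.Finite F V₁ := Submodule.finiteDimensional_of_le inf_le_left
  have hsum : Module.finrank F (V.map τ) + Module.finrank F V₁ = r := by
    rw [← hV, ← LinearMap.finrank_range_add_finrank_ker (τ ∘ₗ V.subtype), LinearMap.range_comp,
      Submodule.range_subtype]
    congr 1
    rw [LinearMap.ker_comp, ← Submodule.finrank_map_subtype_eq V, Submodule.map_comap_subtype]
  have hV₀pos : 1 ≤ Module.finrank F (V.map τ) := by
    obtain ⟨i, hi⟩ := hne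
    rw [Submodule.one_le_finrank_iff]
    intro h
    apply hi
    apply hτ0
    rw [← Submodule.mem_bot F, ← h]
    exact Submodule.mem_map_of_mem (Submodule.subset_span ⟨i, rfl⟩)
  -- If V₁ were zero, `firstMessage` would be injective on V, against `hdep`.
  have hV₁pos : 1 ≤ Module.finrank F V₁ := by
    rw [Submodule.one_le_finrank_iff]
    intro h
    apply hdep
    refine hd.map (f := firstMessage) ?_
    rw [Submodule.disjoint_def]
    intro u hu hu'
    rw [← Submodule.mem_bot F, ← h]
    refine ⟨hu, ?_⟩
    rw [LinearMap.mem_ker] at hu'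
    change (G.map (constantCoeff (R := F))).vecMulLinear (firstMessage u) = 0
    rw [hu', map_zero]
  let S : Finset (Fin n × ℕ) := (finite_messageSupp G d).toFinset
  have hSV : ∀ u ∈ V, ∀ p ∉ S, (Matrix.vecMul u G p.1).coeff p.2 = 0 := by
    intro u hu p hp
    have h1 : encodeCoeffs G u ∈ Submodule.span F (Set.range fun i => encodeCoeffs G (d i)) := by
      have := Submodule.mem_map_of_mem (f := encodeCoeffs G) hu
      rw [Submodule.map_span, ← Set.range_comp] at this
      exact this
    refine apply_eq_zero_of_mem_span (i := p) (fun h => hp ?_) h1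
    rw [Set.Finite.mem_toFinset]
    exact h
  let S₀ : Finset (Fin n) := Finset.univ.filter fun l => (l, 0) ∈ S
  let S₁ : Finset (Fin n × ℕ) := S.filter fun p => p.2 ≠ 0
  have hS : S₀.card + S₁.card ≤ S.card := by
    rw [← Finset.card_filter_add_card_filter_not (s := S) (fun p => p.2 = 0)]
    refine Nat.add_le_add_right (Finset.card_le_card_of_injOn (fun l => (l, 0)) ?_ ?_) _
    · intro l hl
      simpa [S₀] using hl
    · intro a _ b _ h
      exact congrArg Prod.fst h
  have hA₀ := add_finrank_le_card_add_one (V.map τ) S₀ (by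
    rintro _ ⟨u, hu, rfl⟩ l hl
    rw [hτ]
    exact hSV u hu (l, 0) (by simpa [S₀] using hl)) (w₀ + 1) (by
    rintro _ ⟨u, hu, rfl⟩ hne
    exact hw₀ _ fun h => hne (by simp [τ, h])) hV₀pos
  have hrank₁ : Module.finrank F (V₁.map (encodeCoeffs G)) = Module.finrank F V₁ :=
    (Submodule.equivMapOfInjective _ (encodeCoeffs_injective hnc) V₁).finrank_eq.symm
  have hA₁ := add_finrank_le_card_add_one (V₁.map (encodeCoeffs G)) S₁ (by
    rintro _ ⟨u, ⟨hu, hu'⟩, rfl⟩ p hp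
    rw [encodeCoeffs_apply_apply]
    by_cases h0 : p.2 = 0
    · rw [h0, ← hτ, LinearMap.mem_ker.1 hu']
      rfl
    · exact hSV u hu p fun h => hp (Finset.mem_filter.2 ⟨h, h0⟩)) w (by
    rintro _ ⟨u, hu, rfl⟩ hne
    exact hw u fun h => hne (by simp [h])) (by omega)
  have hcard : (messageSupp G d).ncard = S.card := Set.ncard_eq_toFinset_card _ _
  omega

/-- Dividing by X shifts the support without enlarging it. The degree bound N drops each time, so
this ends with nonzero constant terms: either they are independent, or the family is mixed and `hub`
does at least as well. -/
theorem exists_linearIndependent_firstMessage_ncard_le {G : Matrix (Fin k) (Fin n) F[X]}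
    (hnc : IsNoncatastrophic G)
    {w : ℕ} (hw : ∀ u : Fin k → F[X], u ≠ 0 → w ≤ (supp {coeffs (Matrix.vecMul u G)}).ncard)
    {w₀ : ℕ} (hw₀ : ∀ v : Fin k → F, v ≠ 0 →
      w₀ + 1 ≤ (supp {Matrix.vecMul v (G.map (constantCoeff (R := F)))}).ncard)
    {r : ℕ} (hr : 1 ≤ r)
    (hub : ∃ u : Fin r → Fin k → F[X], LinearIndependent F (fun i => firstMessage (u i)) ∧
      (messageSupp G u).ncard + 1 ≤ w₀ + w + r)
    (N : ℕ) (d : Fin r → Fin k → F[X]) (hN : ∀ i a, (d i a).natDegree ≤ N)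
    (hd : LinearIndependent F d) :
    ∃ u : Fin r → Fin k → F[X], LinearIndependent F (fun i => firstMessage (u i)) ∧
      (messageSupp G u).ncard ≤ (messageSupp G d).ncard := by
  by_cases hdep : LinearIndependent F fun i => firstMessage (d i)
  · exact ⟨d, hdep, le_rfl⟩
  by_cases hne : ∃ i, firstMessage (d i) ≠ 0
  · obtain ⟨u, hu, hcard⟩ := hub
    have := add_le_ncard_messageSupp hnc hw hw₀ hd hdep hne
    exact ⟨u, hu, by omega⟩
  push Not at hne
  have hcoeff : ∀ i a, (d i a).coeff 0 = 0 := fun i a => congrFun (hne i) a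
  induction N generalizing d with
  | zero =>
    exfalso
    refine hd.ne_zero ⟨0, hr⟩ ?_
    ext1 a
    rw [eq_C_of_natDegree_le_zero (hN ⟨0, hr⟩ a), hcoeff, C_0]
    rfl
  | succ N ih =>
    let d' : Fin r → Fin k → F[X] := fun i a => (d i a).divX
    have hdd' : ∀ i, d i = (X : F[X]) • d' i := by
      intro i
      ext1 a
      have := X_mul_divX_add (d i a)
      rw [hcoeff, C_0, add_zero] at this
      exact this.symm
    have hvm : ∀ i l, Matrix.vecMul (d i) G l = X * Matrix.vecMul (d' i) G l := by
      intro i l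
      rw [hdd', Matrix.smul_vecMul]
      rfl
    have hd' : LinearIndependent F d' := by
      refine LinearIndependent.of_comp
        ((LinearMap.lsmul F[X] (Fin k → F[X]) X).restrictScalars F) ?_
      convert hd using 1
      ext1 i
      exact (hdd' i).symm
    have hN' : ∀ i a, (d' i a).natDegree ≤ N := by
      intro i a
      have := hN i a
      simp only [d', natDegree_divX_eq_natDegree_tsub_one]
      omega
    have hsupp : (messageSupp G d').ncard ≤ (messageSupp G d).ncard := by
      refine Set.ncard_le_ncard_of_injOn (fun p => (p.1, p.2 + 1)) ?_ ?_ (finite_messageSupp G d)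
      · intro p hp
        obtain ⟨i, hi⟩ := mem_messageSupp.1 hp
        refine mem_messageSupp.2 ⟨i, ?_⟩
        simp only [hvm, coeff_X_mul]
        exact hi
      · rintro ⟨a, b⟩ _ ⟨a', b'⟩ _ h
        simpa using h
    by_cases hdep' : LinearIndependent F fun i => firstMessage (d' i)
    · exact ⟨d', hdep', hsupp⟩
    by_cases hne' : ∃ i, firstMessage (d' i) ≠ 0
    · obtain ⟨u, hu, hcard⟩ := hub
      have := add_le_ncard_messageSupp hnc hw hw₀ hd' hdep' hne'
      exact ⟨u, hu, by omega⟩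
    push Not at hne'
    obtain ⟨u, hu, hcard⟩ := ih d' hN' hd' hdep' hne' fun i a => congrFun (hne' i) a
    exact ⟨u, hu, hcard.trans hsupp⟩

/-! ### Power series messages and truncated distances -/

/-- The generator matrix over the power series ring. -/
def powerSeriesMatrix {a b : ℕ} (G : Matrix (Fin a) (Fin b) F[X]) :
    Matrix (Fin a) (Fin b) (PowerSeries F) :=
  G.map (coeToPowerSeries.ringHom (R := F))

/-- The power series codeword of a sequence of message blocks. -/
def encodeSeq (G : Matrix (Fin k) (Fin n) F[X]) (v : ℕ → Fin k → F) : Fin n → PowerSeries F :=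
  Matrix.vecMul (fun a => PowerSeries.mk fun s => v s a) (powerSeriesMatrix G)

theorem coeff_encodeSeq (G : Matrix (Fin k) (Fin n) F[X]) (v : ℕ → Fin k → F) (l : Fin n) (t : ℕ) :
    PowerSeries.coeff t (encodeSeq G v l) =
      ∑ a, ∑ s ∈ Finset.range (t + 1), v s a * (G a l).coeff (t - s) := by
  simp only [encodeSeq, Matrix.vecMul, dotProduct, map_sum, PowerSeries.coeff_mul]
  refine Finset.sum_congr rfl fun a _ => ?_
  rw [Finset.Nat.sum_antidiagonal_eq_sum_range_succ_mk]
  simp [powerSeriesMatrix]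

theorem vecMul_slidingMatrix (G : Matrix (Fin k) (Fin n) F[X]) (v : ℕ → Fin k → F) (j : ℕ)
    (q : Fin (j + 1) × Fin n) :
    Matrix.vecMul (fun p : Fin (j + 1) × Fin k => v p.1 p.2) (slidingMatrix G j) q =
      PowerSeries.coeff (q.1 : ℕ) (encodeSeq G v q.2) := by
  rw [coeff_encodeSeq]
  simp only [Matrix.vecMul, dotProduct, slidingMatrix]
  rw [Fintype.sum_prod_type_right]
  refine Finset.sum_congr rfl fun a _ => ?_
  simp only [Fin.le_def]
  rw [Fin.sum_univ_eq_sum_range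
    (fun s => v s a * if s ≤ (q.1 : ℕ) then (G a q.2).coeff ((q.1 : ℕ) - s) else 0)]
  have hq := q.1.2
  rw [← Finset.sum_subset (Finset.range_mono (show (q.1 : ℕ) + 1 ≤ j + 1 by omega))]
  · refine Finset.sum_congr rfl fun s hs => ?_
    rw [Finset.mem_range] at hs
    rw [if_pos (by omega)]
  · intro s _ hs
    rw [Finset.mem_range] at hs
    rw [if_neg (by omega), mul_zero]

/-- The support of the code spanned by the codewords of a family of message sequences. -/
def seqSupp {ι : Type*} (G : Matrix (Fin k) (Fin n) F[X]) (v : ι → ℕ → Fin k → F) :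
    Set (Fin n × ℕ) :=
  {p | ∃ i, PowerSeries.coeff p.2 (encodeSeq G (v i) p.1) ≠ 0}

theorem finite_snd_le (S : Set (Fin n × ℕ)) (j : ℕ) : (S ∩ {p | p.2 ≤ j}).Finite :=
  ((Set.finite_univ (α := Fin n)).prod (Set.finite_Iic j)).subset fun _ hp =>
    ⟨Set.mem_univ _, hp.2⟩

theorem ncard_supp_vecMul_slidingMatrix {ι : Type*} (G : Matrix (Fin k) (Fin n) F[X])
    (v : ι → ℕ → Fin k → F) (j : ℕ) :
    (supp (Set.range fun i => Matrix.vecMul (fun p : Fin (j + 1) × Fin k => v i p.1 p.2)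
      (slidingMatrix G j))).ncard = (seqSupp G v ∩ {p | p.2 ≤ j}).ncard := by
  have hmem : ∀ q : Fin (j + 1) × Fin n,
      q ∈ supp (Set.range fun i => Matrix.vecMul (fun p : Fin (j + 1) × Fin k => v i p.1 p.2)
        (slidingMatrix G j)) ↔ (q.2, (q.1 : ℕ)) ∈ seqSupp G v := by
    intro q
    simp [mem_supp, seqSupp, vecMul_slidingMatrix]
  refine Set.ncard_congr (fun q _ => (q.2, (q.1 : ℕ))) ?_ ?_ ?_
  · intro q hq
    exact ⟨(hmem q).1 hq, Nat.lt_succ_iff.1 q.1.2⟩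
  · rintro ⟨a, b⟩ ⟨a', b'⟩ _ _ h
    simp only [Prod.mk.injEq] at h ⊢
    exact ⟨Fin.ext h.2, h.1⟩
  · rintro ⟨l, t⟩ ⟨hp, ht⟩
    exact ⟨(⟨t, Nat.lt_succ_iff.2 ht⟩, l), (hmem _).2 hp, rfl⟩

theorem finrank_span_range_eq_iff {V : Type*} [AddCommGroup V] [Module F V] {r : ℕ}
    {b : Fin r → V} :
    Module.finrank F (Submodule.span F (Set.range b)) = r ↔ LinearIndependent F b := by
  rw [linearIndependent_iff_card_eq_finrank_span, Fintype.card_fin, eq_comm]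
  rfl

/-- Infinite message sequences give one index set for all j, so that different truncations can be
compared; blocks beyond j do not affect the truncated support. -/
theorem truncGeneralizedColumnDistance_eq (G : Matrix (Fin k) (Fin n) F[X]) (r j : ℕ) :
    truncGeneralizedColumnDistance G r j = sInf {m | ∃ v : Fin r → ℕ → Fin k → F,
      LinearIndependent F (fun i => v i 0) ∧ m = (seqSupp G v ∩ {p | p.2 ≤ j}).ncard} := by
  rw [truncGeneralizedColumnDistance]
  congr 1
  ext m
  constructor
  · rintro ⟨v, hv, rfl⟩
    let v' : Fin r → ℕ → Fin k → F := fun i s a =>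
      if h : s < j + 1 then v i (⟨s, h⟩, a) else 0
    have hv' : ∀ i, (fun p : Fin (j + 1) × Fin k => v' i p.1 p.2) = v i := by
      intro i
      ext p
      exact dif_pos p.1.2
    refine ⟨v', ?_, ?_⟩
    · rw [finrank_span_range_eq_iff] at hv
      exact hv
    · rw [← ncard_supp_vecMul_slidingMatrix]
      simp only [hv']
  · rintro ⟨v, hv, rfl⟩
    refine ⟨fun i p => v i p.1 p.2, ?_, (ncard_supp_vecMul_slidingMatrix G v j).symm⟩
    rw [finrank_span_range_eq_iff]
    exact hv

theorem truncGeneralizedColumnDistance_le {G : Matrix (Fin k) (Fin n) F[X]} {r : ℕ}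
    {v : Fin r → ℕ → Fin k → F} (hv : LinearIndependent F (fun i => v i 0)) (j : ℕ) :
    truncGeneralizedColumnDistance G r j ≤ (seqSupp G v ∩ {p | p.2 ≤ j}).ncard := by
  rw [truncGeneralizedColumnDistance_eq]
  exact Nat.sInf_le ⟨v, hv, rfl⟩

theorem exists_truncGeneralizedColumnDistance_eq (G : Matrix (Fin k) (Fin n) F[X]) {r : ℕ}
    (hrk : r ≤ k) (j : ℕ) : ∃ v : Fin r → ℕ → Fin k → F, LinearIndependent F (fun i => v i 0) ∧
      truncGeneralizedColumnDistance G r j = (seqSupp G v ∩ {p | p.2 ≤ j}).ncard := by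
  obtain ⟨f, hf⟩ := exists_linearIndependent_of_le_finrank
    (R := F) (M := Fin k → F) (n := r) (by simpa using hrk)
  rw [truncGeneralizedColumnDistance_eq]
  exact Nat.sInf_mem (s := {m | ∃ v : Fin r → ℕ → Fin k → F,
      LinearIndependent F (fun i => v i 0) ∧ m = (seqSupp G v ∩ {p | p.2 ≤ j}).ncard})
    ⟨_, fun i _ => f i, hf, rfl⟩

theorem monotone_truncGeneralizedColumnDistance (G : Matrix (Fin k) (Fin n) F[X]) {r : ℕ}
    (hrk : r ≤ k) : Monotone fun j => truncGeneralizedColumnDistance G r j := by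
  intro i j hij
  obtain ⟨v, hv, hvj⟩ := exists_truncGeneralizedColumnDistance_eq G hrk j
  change truncGeneralizedColumnDistance G r i ≤ truncGeneralizedColumnDistance G r j
  rw [hvj]
  refine (truncGeneralizedColumnDistance_le hv i).trans (Set.ncard_le_ncard ?_ (finite_snd_le _ _))
  rintro p ⟨hp, hpi⟩
  exact ⟨hp, le_trans hpi hij⟩

theorem encodeSeq_coeff (G : Matrix (Fin k) (Fin n) F[X]) (u : Fin k → F[X]) (l : Fin n) :
    encodeSeq G (fun s a => (u a).coeff s) l = (Matrix.vecMul u G l : F[X]) := by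
  have := RingHom.map_vecMul (coeToPowerSeries.ringHom (R := F)) G u l
  rw [coeToPowerSeries.ringHom_apply] at this
  rw [this]
  rfl

theorem seqSupp_coeff {ι : Type*} (G : Matrix (Fin k) (Fin n) F[X]) (u : ι → Fin k → F[X]) :
    seqSupp G (fun i s a => (u i a).coeff s) = messageSupp G u := by
  ext p
  rw [mem_messageSupp]
  simp [seqSupp, encodeSeq_coeff]

theorem truncGeneralizedColumnDistance_le_messageSupp {G : Matrix (Fin k) (Fin n) F[X]} {r : ℕ}
    {u : Fin r → Fin k → F[X]} (hu : LinearIndependent F (fun i => firstMessage (u i))) (j : ℕ) :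
    truncGeneralizedColumnDistance G r j ≤ (messageSupp G u).ncard := by
  refine (truncGeneralizedColumnDistance_le (v := fun i s a => (u i a).coeff s) hu j).trans ?_
  rw [seqSupp_coeff]
  exact Set.ncard_le_ncard Set.inter_subset_left (finite_messageSupp G u)

/-! ### Passage to the limit and return to polynomials -/

/-- Over a finite field, if all truncated generalized column distances are at most `D` then some
family of message sequences attains this without truncation. -/
theorem exists_seqSupp_ncard_le [Finite F] {G : Matrix (Fin k) (Fin n) F[X]} {r D : ℕ}
    (hrk : r ≤ k) (hD : ∀ j, truncGeneralizedColumnDistance G r j ≤ D) :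
    ∃ v : Fin r → ℕ → Fin k → F, LinearIndependent F (fun i => v i 0) ∧
      (seqSupp G v).Finite ∧ (seqSupp G v).ncard ≤ D := by
  choose w hw hwD using exists_truncGeneralizedColumnDistance_eq G hrk
  let 𝒰 : Ultrafilter ℕ := hyperfilter ℕ
  -- Finiteness of F makes every coordinate constant along the ultrafilter.
  have hlim : ∀ i s a, ∃ x, ∀ᶠ j in 𝒰, w j i s a = x := fun i s a =>
    Ultrafilter.eventually_exists_iff.1 (Eventually.of_forall fun j => ⟨_, rfl⟩)
  choose v hv using hlim
  have hagree : ∀ N, ∃ j, N ≤ j ∧ ∀ i, ∀ s ≤ N, ∀ a, w j i s a = v i s a := by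
    intro N
    have h1 : ∀ᶠ j in (𝒰 : Filter ℕ), N ≤ j := by
      have hle : (𝒰 : Filter ℕ) ≤ atTop := Nat.hyperfilter_le_atTop
      exact hle (eventually_ge_atTop N)
    have h2 : ∀ᶠ j in (𝒰 : Filter ℕ), ∀ i, ∀ s ∈ Set.Iic N, ∀ a, w j i s a = v i s a := by
      rw [eventually_all]
      intro i
      rw [eventually_all_finite (Set.finite_Iic N)]
      intro s _
      rw [eventually_all]
      exact hv i s
    obtain ⟨j, hj⟩ := (h1.and h2).exists
    exact ⟨j, hj⟩
  have hbound : ∀ N, (seqSupp G v ∩ {p | p.2 ≤ N}).ncard ≤ D := by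
    intro N
    obtain ⟨j, hNj, hj⟩ := hagree N
    refine le_trans (Set.ncard_le_ncard ?_ (finite_snd_le _ _)) ((hwD j).symm.trans_le (hD j))
    rintro p ⟨⟨i, hi⟩, hpN⟩
    refine ⟨⟨i, ?_⟩, le_trans hpN hNj⟩
    convert hi using 1
    rw [coeff_encodeSeq, coeff_encodeSeq]
    refine Finset.sum_congr rfl fun a _ => Finset.sum_congr rfl fun s hs => ?_
    rw [hj i s]
    have : p.2 ≤ N := hpN
    rw [Finset.mem_range] at hs
    omega
  -- Bounding finite subsets yields finiteness of the support; a bound on `ncard` alone would not,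
  -- since it is 0 on infinite sets.
  have hfinset : ∀ T : Finset (Fin n × ℕ), (T : Set (Fin n × ℕ)) ⊆ seqSupp G v → T.card ≤ D := by
    intro T hT
    rw [← Set.ncard_coe_finset]
    refine le_trans (Set.ncard_le_ncard ?_ (finite_snd_le _ _)) (hbound (T.sup Prod.snd))
    intro p hp
    exact ⟨hT hp, Finset.le_sup (f := Prod.snd) hp⟩
  have hfin : (seqSupp G v).Finite := by
    by_contra hinf
    obtain ⟨T, hT, hcard⟩ := Set.Infinite.exists_subset_card_eq hinf (D + 1)
    have := hfinset T hT
    omega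
  refine ⟨v, ?_, hfin, ?_⟩
  · obtain ⟨j, _, hj⟩ := hagree 0
    convert hw j using 1
    ext i a
    exact (hj i 0 le_rfl a).symm
  · rw [Set.ncard_eq_toFinset_card _ hfin]
    exact hfinset _ (by simp)

/-- Finite support makes the codewords polynomial, and multiplying by the polynomial right inverse H
recovers the messages. -/
theorem exists_coeff_eq_of_finite_seqSupp {ι : Type*} [Finite ι] {G : Matrix (Fin k) (Fin n) F[X]}
    (hnc : IsNoncatastrophic G) {v : ι → ℕ → Fin k → F} (hfin : (seqSupp G v).Finite) :
    ∃ u : ι → Fin k → F[X], v = fun i s a => (u i a).coeff s := by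
  obtain ⟨H, hH⟩ := hnc
  obtain ⟨N, hN⟩ := (hfin.image Prod.snd).bddAbove
  let c : ι → Fin n → F[X] := fun i l => PowerSeries.trunc (N + 1) (encodeSeq G (v i) l)
  have hc : ∀ i l, (c i l : PowerSeries F) = encodeSeq G (v i) l := by
    intro i l
    ext t
    rw [coeff_coe, PowerSeries.coeff_trunc]
    split_ifs with h
    · rfl
    · by_contra hne
      have := hN ⟨(l, t), ⟨i, Ne.symm hne⟩, rfl⟩
      exact h (Nat.lt_succ_iff.2 this)
  refine ⟨fun i => Matrix.vecMul (c i) H, ?_⟩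
  ext i s a
  have h1 : (Matrix.vecMul (c i) H a : F[X]) =
      Matrix.vecMul (encodeSeq G (v i)) (powerSeriesMatrix H) a := by
    have := RingHom.map_vecMul (coeToPowerSeries.ringHom (R := F)) H (c i) a
    rw [coeToPowerSeries.ringHom_apply] at this
    rw [this]
    congr 1
    ext1 l
    exact hc i l
  have h2 : powerSeriesMatrix G * powerSeriesMatrix H = 1 := by
    rw [powerSeriesMatrix, powerSeriesMatrix, ← Matrix.map_mul, hH]
    exact Matrix.map_one _ (map_zero _) (map_one _)
  rw [encodeSeq, Matrix.vecMul_vecMul, h2, Matrix.vecMul_one] at h1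
  rw [← coeff_coe, h1, PowerSeries.coeff_mk]

/-- The constant term of a relation forces all its coefficients to be divisible by X; cancel X and
repeat. -/
theorem linearIndependent_of_firstMessage {ι : Type*} [Fintype ι] {u : ι → Fin k → F[X]}
    (hu : LinearIndependent F (fun i => firstMessage (u i))) : LinearIndependent F[X] u := by
  rw [Fintype.linearIndependent_iff] at hu ⊢
  have key : ∀ N, ∀ p : ι → F[X], ∑ i, p i • u i = 0 → ∀ i, (p i).coeff N = 0 := by
    intro N
    induction N with
    | zero =>
      intro p hp
      refine hu _ ?_
      ext a
      have := congrArg (fun q => (q a).coeff 0) hp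
      simpa [finsetSum_coeff, mul_coeff_zero] using this
    | succ N ih =>
      intro p hp i
      have h0 : ∀ i, (p i).coeff 0 = 0 := by
        refine hu _ ?_
        ext a
        have := congrArg (fun q => (q a).coeff 0) hp
        simpa [finsetSum_coeff, mul_coeff_zero] using this
      have hdiv : ∀ i, p i = X * (p i).divX := fun i => by
        have := X_mul_divX_add (p i)
        rw [h0, C_0, add_zero] at this
        exact this.symm
      rw [← coeff_divX]
      refine ih (fun i => (p i).divX) ?_ i
      have hX : (X : F[X]) • ∑ i, (p i).divX • u i = 0 := by
        rw [Finset.smul_sum, ← hp]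
        refine Finset.sum_congr rfl fun i _ => ?_
        rw [smul_smul, ← hdiv]
      exact (smul_eq_zero.1 hX).resolve_left X_ne_zero
  intro p hp i
  ext N
  rw [key N p hp i, coeff_zero]

/-! ### Distances of the code in terms of messages -/

theorem IsGeneratorMatrix.mem_iff {C : Submodule F[X] (Fin n → F[X])}
    {G : Matrix (Fin k) (Fin n) F[X]} (hG : IsGeneratorMatrix C G) {c : Fin n → F[X]} :
    c ∈ C ↔ ∃ u, Matrix.vecMul u G = c := by
  rw [← hG.2, ← range_vecMulLinear]
  rfl

theorem generalizedWeight_le_messageSupp {C : Submodule F[X] (Fin n → F[X])}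
    {G : Matrix (Fin k) (Fin n) F[X]} (hG : IsGeneratorMatrix C G) (hnc : IsNoncatastrophic G)
    {r : ℕ} {u : Fin r → Fin k → F[X]} (hu : LinearIndependent F (fun i => firstMessage (u i))) :
    generalizedWeight C r ≤ (messageSupp G u).ncard := by
  refine Nat.sInf_le ⟨fun i => Matrix.vecMul (u i) G, fun i => hG.mem_iff.2 ⟨_, rfl⟩, ?_, rfl⟩
  have h : LinearIndependent F[X] fun i => Matrix.vecMul (u i) G :=
    (linearIndependent_of_firstMessage hu).map' G.vecMulLinear
      (LinearMap.ker_eq_bot.2 (encode_injective hnc))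
  rw [finrank_span_eq_card h, Fintype.card_fin]

theorem exists_messageSupp_ncard_eq_generalizedWeight {C : Submodule F[X] (Fin n → F[X])}
    {G : Matrix (Fin k) (Fin n) F[X]} (hG : IsGeneratorMatrix C G)
    {r : ℕ} (hrk : r ≤ k) : ∃ d : Fin r → Fin k → F[X], LinearIndependent F d ∧
      generalizedWeight C r = (messageSupp G d).ncard := by
  obtain ⟨c, hcC, hcr, hc⟩ := Nat.sInf_mem (s := {m | ∃ d : Fin r → Fin n → F[X],
    (∀ i, d i ∈ C) ∧ r ≤ Module.finrank F[X] (Submodule.span F[X] (Set.range d)) ∧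
    m = (supp (Set.range fun i => coeffs (d i))).ncard}) (by
      -- The first r rows of G show that the infimum is over a nonempty set.
      refine ⟨_, fun i => G.row (Fin.castLE hrk i), fun i => ?_, ?_, rfl⟩
      · rw [← hG.2]
        exact Submodule.subset_span ⟨_, rfl⟩
      · have h : LinearIndependent F[X] fun i => G.row (Fin.castLE hrk i) :=
          hG.1.comp _ (Fin.castLE_injective hrk)
        rw [finrank_span_eq_card h, Fintype.card_fin])
  choose d hd using fun i => hG.mem_iff.1 (hcC i)
  have hcli : LinearIndependent F[X] c := by
    rw [linearIndependent_iff_card_le_finrank_span, Fintype.card_fin]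
    exact hcr
  refine ⟨d, ?_, ?_⟩
  · have h : LinearIndependent F[X] d := by
      refine LinearIndependent.of_comp G.vecMulLinear ?_
      convert hcli using 1
      ext1 i
      exact hd i
    exact h.restrict_scalars' F
  · rw [messageSupp]
    simp only [hd]
    exact hc

theorem freeDistance_le {C : Submodule F[X] (Fin n → F[X])} {G : Matrix (Fin k) (Fin n) F[X]}
    (hG : IsGeneratorMatrix C G) (hnc : IsNoncatastrophic G) {u : Fin k → F[X]} (hu : u ≠ 0) :
    freeDistance C ≤ (supp {coeffs (Matrix.vecMul u G)}).ncard := by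
  refine Nat.sInf_le ⟨_, hG.mem_iff.2 ⟨u, rfl⟩, fun h => hu ?_, rfl⟩
  exact encode_injective hnc (by simpa using h)

theorem columnDistance_zero_le (G : Matrix (Fin k) (Fin n) F[X]) {v : Fin k → F} (hv : v ≠ 0) :
    columnDistance G 0 ≤ (supp {Matrix.vecMul v (G.map (constantCoeff (R := F)))}).ncard := by
  refine le_trans (Nat.sInf_le ⟨fun p => v p.2, hv, rfl⟩) ?_
  have hvm : ∀ q, Matrix.vecMul (fun p : Fin 1 × Fin k => v p.2) (slidingMatrix G 0) q =
      Matrix.vecMul v (G.map (constantCoeff (R := F))) q.2 := by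
    intro q
    simp [Matrix.vecMul, dotProduct, slidingMatrix, Fintype.sum_prod_type]
  refine Set.ncard_le_ncard_of_injOn Prod.snd ?_ ?_ (Set.toFinite _)
  · rintro q ⟨_, rfl, hq⟩
    rw [hvm] at hq
    exact ⟨_, rfl, hq⟩
  · rintro ⟨a, b⟩ _ ⟨a', b'⟩ _ h
    exact Prod.ext (Subsingleton.elim (α := Fin 1) _ _) h

end ConvCode

end

/-! ### Equality of the two weights -/

theorem mainTheorem11 {F : Type*} [Field F] [Finite F] {n k : ℕ}
    (C : Submodule F[X] (Fin n → F[X])) (G : Matrix (Fin k) (Fin n) F[X])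
    (hG : ConvCode.IsGeneratorMatrix C G) (hnc : ConvCode.IsNoncatastrophic G)
    (hMDS : ConvCode.IsMDS C G) (hMDP : ConvCode.IsMDP G)
    (r : ℕ) (hr : 1 ≤ r) (hrk : r ≤ k) :
    Tendsto (fun j => ConvCode.truncGeneralizedColumnDistance G r j) atTop
        (𝓝 (ConvCode.generalizedColumnDistance G r)) ∧
      ConvCode.generalizedWeight C r = ConvCode.generalizedColumnDistance G r := by
  open ConvCode in
  have hkn : k ≤ n := by
    simpa using hG.1.fintype_card_le_finrank
  have hw : ∀ u : Fin k → F[X], u ≠ 0 →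
      freeDistance C ≤ (supp {coeffs (Matrix.vecMul u G)}).ncard :=
    fun u hu => freeDistance_le hG hnc hu
  have hw₀ : ∀ v : Fin k → F, v ≠ 0 →
      (n - k) + 1 ≤ (supp {Matrix.vecMul v (G.map (constantCoeff (R := F)))}).ncard := by
    intro v hv
    -- At j = 0, MDP says that the block code generated by G(0) has minimum distance n - k + 1.
    have h := hMDP 0 (Nat.zero_le _)
    rw [zero_add, mul_one] at h
    rw [← h]
    exact columnDistance_zero_le G hv
  have hub := exists_linearIndependent_firstMessage_of_boundedMessages hnc (hr.trans hrk) hkn hw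
    hMDS hrk
  obtain ⟨u₀, hu₀, -⟩ := id hub
  have hbdd : BddAbove (Set.range fun j => truncGeneralizedColumnDistance G r j) := by
    refine ⟨(messageSupp G u₀).ncard, ?_⟩
    rintro _ ⟨j, rfl⟩
    exact truncGeneralizedColumnDistance_le_messageSupp hu₀ j
  have hlim := tendsto_atTop_ciSup (monotone_truncGeneralizedColumnDistance G hrk) hbdd
  have hD : generalizedColumnDistance G r = ⨆ j, truncGeneralizedColumnDistance G r j :=
    hlim.limUnder_eq
  rw [hD]
  refine ⟨hlim, le_antisymm ?_ ?_⟩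
  · obtain ⟨v, hv, hfin, hcard⟩ := exists_seqSupp_ncard_le hrk fun j => le_ciSup hbdd j
    obtain ⟨u, rfl⟩ := exists_coeff_eq_of_finite_seqSupp hnc hfin
    rw [seqSupp_coeff] at hcard
    exact (generalizedWeight_le_messageSupp hG hnc hv).trans hcard
  · obtain ⟨d, hd, hdw⟩ := exists_messageSupp_ncard_eq_generalizedWeight hG hrk
    rw [hdw]
    obtain ⟨u, hu, hle⟩ := exists_linearIndependent_firstMessage_ncard_le hnc hw hw₀ hr hub
      (Finset.univ.sup fun i => Finset.univ.sup fun a => (d i a).natDegree) d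
      (fun i a => (Finset.le_sup (f := fun a => (d i a).natDegree) (Finset.mem_univ a)).trans
        (Finset.le_sup (f := fun i => Finset.univ.sup fun a => (d i a).natDegree)
          (Finset.mem_univ i))) hd
    exact (ciSup_le fun j => truncGeneralizedColumnDistance_le_messageSupp hu j).trans hle
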